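/- Let $\mathcal H$ be the Hilbert space of one bosonic mode, with Fock basis $|0\rangle,|1\rangle,|2\rangle,\dots$. A state is a positive operator $\rho$ on $\mathcal H$ with unit trace; it has finite Fock support if $\langle k|\rho|k\rangle\neq 0$ for only finitely many $k$. For a two-mode unitary $U$ on $\mathcal H\otimes\mathcal H$ (system $\otimes$ environment) and $n\in\{0,1,2,\dots\}$, the $n$-photon-added channel of $U$ is $$\Phi(\rho)=\mathrm{Tr}_E\bigl[U\,(\rho\otimes|n\rangle\langle n|)\,U^\dagger\bigr].$$ The photon-added amplifier $\mathcal A(\kappa;n)$ ($\kappa\ge 1$), attenuator $\mathcal B(\kappa;n)$ ($0\le\kappa\le1$) and phase-conjugation channel $\mathcal C(\kappa;n)$ ($\kappa\ge0$) are the channels obtained from the unitaries of the corresponding quantum-limited Gaussian channels, whose Fock matrix elements $\langle m_1,m_2|U|n_1,n_2\rangle$ are, respectively, $$\kappa^{-1}\sqrt{\tfrac{n_1!\,m_2!}{m_1!\,n_2!}}\sum_{r=0}^{n_2}\sum_{j=0}^{m_1}\tbinom{n_2}{r}\tbinom{m_1}{j}(-1)^r(\kappa^{-1})^{n_2+j-r}\bigl(\sqrt{1-\kappa^{-2}}\bigr)^{m_1+r-j}\delta_{n_1,r+j}\,\delta_{m_2,n_2+m_1-r-j},$$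 $$\sqrt{\tfrac{m_1!\,m_2!}{n_1!\,n_2!}}\sum_{r=0}^{n_1}\sum_{j=0}^{n_2}\tbinom{n_1}{r}\tbinom{n_2}{j}(-1)^{n_2-j}\kappa^{n_1-r+j}\bigl(\sqrt{1-\kappa^2}\bigr)^{r+n_2-j}\delta_{m_2,r+j}\,\delta_{m_1,n_1+n_2-r-j},$$ $$\tfrac{1}{\sqrt{1+\kappa^2}}\sqrt{\tfrac{n_2!\,m_2!}{m_1!\,n_1!}}\sum_{r=0}^{m_1}\sum_{j=0}^{n_1}\tbinom{m_1}{r}\tbinom{n_1}{j}(-1)^j\Bigl(\tfrac{1}{\sqrt{1+\kappa^2}}\Bigr)^{n_1+r-j}\Bigl(\tfrac{\kappa}{\sqrt{1+\kappa^2}}\Bigr)^{m_1-r+j}\delta_{n_2,r+j}\,\delta_{m_2,n_1+m_1-r-j}.$$ Corollary. There is no state $\rho$ with finite Fock support and $\Phi(\rho)=\rho$ when $\Phi$ is any of the following channels: (i) the photon-added attenuator $\mathcal B(\kappa;n)$ with $0<\kappa<1$ and $n\ge1$; (ii) the photon-added amplifier $\mathcal A(\kappa;n)$ with $\kappa>1$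 and $n\ge0$; (iii) the photon-added phase-conjugation channel $\mathcal C(\kappa;n)$ with $\kappa>0$ and $n\ge0$. -/

import Mathlib

open scoped Nat Kronecker Matrix

noncomputable section

namespace PhotonAdded

/-- The Hilbert space of a single bosonic mode, realised as `ℓ²(ℕ)`. -/
abbrev Mode : Type := lp (fun _ : ℕ => ℂ) 2

/-- The Fock (number) state `|k⟩`, i.e. the `k`-th standard basis vector. -/
def fock (k : ℕ) : Mode := lp.single 2 k (1 : ℂ)

/-- The matrix `⟨i|ρ|j⟩` of an operator in the Fock basis; it determines the operator. -/
def fockMatrix (ρ : Mode →L[ℂ] Mode) : Matrix ℕ ℕ ℂ :=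
  Matrix.of fun i j => inner ℂ (fock i) (ρ (fock j))

/-- `ρ` is a state (density operator): positive with unit trace. -/
def IsState (ρ : Mode →L[ℂ] Mode) : Prop :=
  ρ.IsPositive ∧ HasSum (fun k => fockMatrix ρ k k) 1

/-- The Fock support of `ρ`: the set of `k` with `⟨k|ρ|k⟩ ≠ 0`. -/
def fockSupport (ρ : Mode →L[ℂ] Mode) : Set ℕ := {k | fockMatrix ρ k k ≠ 0}

/-- Product of infinite matrices. -/
def mulInf {ι : Type} (M N : Matrix ι ι ℂ) : Matrix ι ι ℂ :=
  Matrix.of fun i j => ∑' k, M i k * N k j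

/-- Partial trace over the second (environment) mode, in the Fock basis. -/
def traceEnv (M : Matrix (ℕ × ℕ) (ℕ × ℕ) ℂ) : Matrix ℕ ℕ ℂ :=
  Matrix.of fun i j => ∑' k, M (i, k) (j, k)

/-- The channel `ρ ↦ Tr_E [U (ρ ⊗ |n⟩⟨n|) U†]` in the Fock basis: two-mode unitary `U`, environment
in the `n`-photon state. For each two-mode matrix `U` below, every sum over two-mode indices in it
has at most one non-zero term, and the trace converges absolutely if `ρ` is a state. -/
def photonAdded (U : Matrix (ℕ × ℕ) (ℕ × ℕ) ℂ) (n : ℕ) (ρ : Matrix ℕ ℕ ℂ) : Matrix ℕ ℕ ℂ :=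
  traceEnv (mulInf (mulInf U (ρ ⊗ₖ Matrix.single n n (1 : ℂ))) Uᴴ)

/-- Two-mode unitary of the quantum-limited amplifier (two-mode squeezer), `κ ≥ 1`: its matrix
elements `⟨m₁,m₂|U|n₁,n₂⟩`. -/
def ampUnitary (κ : ℝ) : Matrix (ℕ × ℕ) (ℕ × ℕ) ℂ :=
  Matrix.of fun m n =>
    ((κ⁻¹ * √((n.1 ! * m.2 ! : ℝ) / (m.1 ! * n.2 !)) *
      ∑ r ∈ Finset.range (n.2 + 1), ∑ j ∈ Finset.range (m.1 + 1),
        if n.1 = r + j ∧ m.2 = n.2 + m.1 - r - j then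
          (n.2.choose r : ℝ) * (m.1.choose j : ℝ) * (-1) ^ r * (κ⁻¹) ^ (n.2 + j - r) *
            √(1 - (κ⁻¹) ^ 2) ^ (m.1 + r - j)
        else 0 : ℝ) : ℂ)

/-- Two-mode unitary of the quantum-limited attenuator (beamsplitter), `0 ≤ κ ≤ 1`: its matrix
elements `⟨m₁,m₂|U|n₁,n₂⟩`. -/
def attUnitary (κ : ℝ) : Matrix (ℕ × ℕ) (ℕ × ℕ) ℂ :=
  Matrix.of fun m n =>
    ((√((m.1 ! * m.2 ! : ℝ) / (n.1 ! * n.2 !)) *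
      ∑ r ∈ Finset.range (n.1 + 1), ∑ j ∈ Finset.range (n.2 + 1),
        if m.2 = r + j ∧ m.1 = n.1 + n.2 - r - j then
          (n.1.choose r : ℝ) * (n.2.choose j : ℝ) * (-1) ^ (n.2 - j) * κ ^ (n.1 - r + j) *
            √(1 - κ ^ 2) ^ (r + n.2 - j)
        else 0 : ℝ) : ℂ)

/-- Two-mode unitary of the quantum-limited phase conjugator, `κ ≥ 0`: its matrix elements
`⟨m₁,m₂|U|n₁,n₂⟩`. The factor `κ / √(1 + κ²)` is `1 / √(1 + κ⁻²)`, written so that it is also right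
at `κ = 0`. -/
def conjUnitary (κ : ℝ) : Matrix (ℕ × ℕ) (ℕ × ℕ) ℂ :=
  Matrix.of fun m n =>
    (((√(1 + κ ^ 2))⁻¹ * √((n.2 ! * m.2 ! : ℝ) / (m.1 ! * n.1 !)) *
      ∑ r ∈ Finset.range (m.1 + 1), ∑ j ∈ Finset.range (n.1 + 1),
        if n.2 = r + j ∧ m.2 = n.1 + m.1 - r - j then
          (m.1.choose r : ℝ) * (n.1.choose j : ℝ) * ((√(1 + κ ^ 2))⁻¹) ^ (n.1 + r - j) *
            (-1) ^ j * (κ / √(1 + κ ^ 2)) ^ (m.1 - r + j)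
        else 0 : ℝ) : ℂ)

/-- The photon-added amplifier channel. -/
def amplifier (κ : ℝ) (n : ℕ) : Matrix ℕ ℕ ℂ → Matrix ℕ ℕ ℂ := photonAdded (ampUnitary κ) n

/-- The photon-added attenuator channel. -/
def attenuator (κ : ℝ) (n : ℕ) : Matrix ℕ ℕ ℂ → Matrix ℕ ℕ ℂ := photonAdded (attUnitary κ) n

/-- The photon-added phase-conjugation channel. -/
def phaseConjugator (κ : ℝ) (n : ℕ) : Matrix ℕ ℕ ℂ → Matrix ℕ ℕ ℂ :=
  photonAdded (conjUnitary κ) n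

/-- `ρ` is a fixed point of the channel `Φ`: `Φ(ρ) = ρ`, as matrices in the Fock basis. -/
def IsFixedPoint (Φ : Matrix ℕ ℕ ℂ → Matrix ℕ ℕ ℂ) (ρ : Mode →L[ℂ] Mode) : Prop :=
  Φ (fockMatrix ρ) = fockMatrix ρ

end PhotonAdded

end

/-! Let `c` be the highest populated level of a finitely supported state. A photon-number
conservation law makes every sum in `U (ρ ⊗ |n⟩⟨n|) U†` a single term, so the output population of a
level `i` is a sum of squared moduli of amplitudes times populations. If `i > c` and the state is
fixed, this sum is zero, hence so is each term; one non-zero amplitude from `c` to `i` is a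
contradiction (`not_exists_isFixedPoint`). For the attenuator, `i = c + n` works. For the other two
channels an amplitude may vanish by interference, but up to a non-zero factor it is a non-zero
polynomial in `i`, so it survives at some large `i` (`exists_sum_mul_choose_ne_zero`). -/

namespace PhotonAdded

open scoped ComplexOrder

/-- A state has non-negative populations. -/
lemma IsState.fockMatrix_diag_nonneg {ρ : Mode →L[ℂ] Mode} (h : IsState ρ) (k : ℕ) :
    0 ≤ fockMatrix ρ k k :=
  h.1.inner_nonneg_right (fock k)

lemma IsState.fockSupport_nonempty {ρ : Mode →L[ℂ] Mode} (h : IsState ρ) :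
    (fockSupport ρ).Nonempty := by
  by_contra hne
  have hz : (fun k => fockMatrix ρ k k) = fun _ => 0 := by
    funext k
    by_contra hk
    exact hne ⟨k, hk⟩
  have h1 := h.2
  rw [hz] at h1
  exact zero_ne_one (hasSum_zero.unique h1)

/-- If the output `(i, e)` can only be reached from the input `c`, the corresponding diagonal
element of `U (ρ ⊗ |n⟩⟨n|) U†` is a transition probability times a population. -/
lemma mulInf_diag_eq (U : Matrix (ℕ × ℕ) (ℕ × ℕ) ℂ) (n : ℕ) (ρ : Matrix ℕ ℕ ℂ) (i e c : ℕ)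
    (hc : ∀ c', c' ≠ c → U (i, e) (c', n) = 0) :
    mulInf (mulInf U (ρ ⊗ₖ Matrix.single n n (1 : ℂ))) Uᴴ (i, e) (i, e) =
      U (i, e) (c, n) * star (U (i, e) (c, n)) * ρ c c := by
  have inner_eq : ∀ a b, mulInf U (ρ ⊗ₖ Matrix.single n n (1 : ℂ)) (i, e) (a, b) =
      if n = b then U (i, e) (c, n) * ρ c a else 0 := by
    intro a b
    simp only [mulInf, Matrix.of_apply]
    rw [tsum_eq_single (c, n)]
    · by_cases hb : n = b <;> simp [Matrix.kroneckerMap_apply, hb]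
    · rintro ⟨c', d⟩ hne
      by_cases hd : n = d
      · subst hd
        have hc' : c' ≠ c := fun h => hne (by rw [h])
        rw [hc c' hc', zero_mul]
      · simp [Matrix.kroneckerMap_apply, hd]
  rw [mulInf, Matrix.of_apply, tsum_eq_single (c, n)]
  · rw [inner_eq, if_pos rfl, Matrix.conjTranspose_apply]
    ring
  · rintro ⟨a, b⟩ hne
    rw [inner_eq]
    by_cases hb : n = b
    · subst hb
      have ha : a ≠ c := fun h => hne (by rw [h])
      rw [Matrix.conjTranspose_apply, hc a ha, star_zero, mul_zero]
    · rw [if_neg hb, zero_mul]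

/-- Suppose that at fixed system output the system input and the environment output determine each
other. If a populated level is mapped with non-zero amplitude to an unpopulated level, then a
finitely supported state is not a fixed point of the photon-added channel. -/
lemma not_isFixedPoint_of_leak {U : Matrix (ℕ × ℕ) (ℕ × ℕ) ℂ} {n : ℕ} {ρ : Mode →L[ℂ] Mode}
    (hρ : IsState ρ) (hfin : (fockSupport ρ).Finite) {i e c : ℕ}
    (hin : ∀ e' c₁ c₂, U (i, e') (c₁, n) ≠ 0 → U (i, e') (c₂, n) ≠ 0 → c₁ = c₂)
    (hout : ∀ c' e₁ e₂, U (i, e₁) (c', n) ≠ 0 → U (i, e₂) (c', n) ≠ 0 → e₁ = e₂)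
    (hc : c ∈ fockSupport ρ) (hi : i ∉ fockSupport ρ) (hU : U (i, e) (c, n) ≠ 0) :
    ¬ IsFixedPoint (photonAdded U n) ρ := by
  intro hfix
  set T : ℕ → ℂ := fun e' => mulInf (mulInf U (fockMatrix ρ ⊗ₖ Matrix.single n n (1 : ℂ))) Uᴴ
    (i, e') (i, e') with hT
  have hTeq : ∀ e' c', U (i, e') (c', n) ≠ 0 →
      T e' = U (i, e') (c', n) * star (U (i, e') (c', n)) * fockMatrix ρ c' c' := by
    intro e' c' h
    refine mulInf_diag_eq U n _ i e' c' fun c'' hne => ?_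
    by_contra h0
    exact hne (hin e' _ _ h0 h)
  have hTzero : ∀ e', (∀ c', U (i, e') (c', n) = 0) → T e' = 0 := by
    intro e' h
    have := mulInf_diag_eq U n (fockMatrix ρ) i e' 0 fun c'' _ => h c''
    simpa [h 0] using this
  have hTnonneg : ∀ e', 0 ≤ T e' := by
    intro e'
    by_cases h : ∃ c', U (i, e') (c', n) ≠ 0
    · obtain ⟨c', h⟩ := h
      rw [hTeq e' c' h]
      exact mul_nonneg (mul_star_self_nonneg _) (hρ.fockMatrix_diag_nonneg c')
    · push Not at h
      exact (hTzero e' h).ge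
  -- Finiteness matters: `∑'` is 0 by convention for a non-summable family, and would then say
  -- nothing about the terms.
  have hsupp : (Function.support T).Finite := by
    refine (hfin.biUnion (t := fun c' => {e' | U (i, e') (c', n) ≠ 0}) fun c' _ =>
      Set.Subsingleton.finite fun e₁ h₁ e₂ h₂ => hout c' e₁ e₂ h₁ h₂).subset fun e' he' => ?_
    by_cases h : ∃ c', U (i, e') (c', n) ≠ 0
    · obtain ⟨c', h⟩ := h
      have h0 : T e' ≠ 0 := he'
      rw [hTeq e' c' h] at h0
      exact Set.mem_biUnion (show c' ∈ fockSupport ρ from right_ne_zero_of_mul h0) h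
    · push Not at h
      exact absurd (hTzero e' h) he'
  have hsum : ∑' e', T e' = 0 := by
    have h := congrFun (congrFun hfix i) i
    have h0 : fockMatrix ρ i i = 0 := not_not.mp hi
    rw [h0] at h
    exact h
  have hTe : T e = 0 := by
    rw [tsum_eq_sum (s := hsupp.toFinset) fun b hb => by simpa using hb] at hsum
    by_contra hne
    exact hne ((Finset.sum_eq_zero_iff_of_nonneg fun e' _ => hTnonneg e').1 hsum e
      (by simpa using hne))
  rw [hTeq e c hU] at hTe
  exact mul_ne_zero (mul_ne_zero hU (star_ne_zero.2 hU)) hc hTe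

/-- A finitely supported state is not a fixed point if the channel raises its highest populated
level. -/
lemma not_exists_isFixedPoint {U : Matrix (ℕ × ℕ) (ℕ × ℕ) ℂ} {n : ℕ}
    (hin : ∀ i e c₁ c₂, U (i, e) (c₁, n) ≠ 0 → U (i, e) (c₂, n) ≠ 0 → c₁ = c₂)
    (hout : ∀ i c e₁ e₂, U (i, e₁) (c, n) ≠ 0 → U (i, e₂) (c, n) ≠ 0 → e₁ = e₂)
    (hU : ∀ c, ∃ i e, c < i ∧ U (i, e) (c, n) ≠ 0) :
    ¬ ∃ ρ : Mode →L[ℂ] Mode, IsState ρ ∧ (fockSupport ρ).Finite ∧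
      IsFixedPoint (photonAdded U n) ρ := by
  rintro ⟨ρ, hρ, hfin, hfix⟩
  obtain ⟨c, hc, hmax⟩ := hfin.exists_maximalFor id _ hρ.fockSupport_nonempty
  obtain ⟨i, e, hlt, hne⟩ := hU c
  exact not_isFixedPoint_of_leak hρ hfin (hin i) (hout i) hc
    (fun hi => (hmax hi hlt.le).not_gt hlt) hne hfix

/-- A combination of the binomial polynomials `i ↦ i.choose (M - r)` whose coefficient of
`i.choose M` is non-zero does not vanish for all large `i`. -/
lemma exists_sum_mul_choose_ne_zero (a : ℕ → ℝ) (ha : a 0 ≠ 0) (M N : ℕ) :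
    ∃ i, N ≤ i ∧ ∑ r ∈ Finset.range (M + 1), a r * (i.choose (M - r) : ℝ) ≠ 0 := by
  induction M with
  | zero => exact ⟨N, le_rfl, by simpa using ha⟩
  | succ M ih =>
    obtain ⟨i, hi, hne⟩ := ih
    -- Pascal's rule: the forward difference in `i` of the sum for `M + 1` is the sum for `M`. The
    -- term `r = M + 1` is constant in `i` and cancels.
    by_contra! hzero
    have h0 := hzero i hi
    have h1 := hzero (i + 1) (by omega)
    apply hne
    rw [Finset.sum_range_succ] at h0 h1
    have key : ∑ r ∈ Finset.range (M + 1), a r * ((i + 1).choose (M + 1 - r) : ℝ) =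
        ∑ r ∈ Finset.range (M + 1), a r * (i.choose (M - r) : ℝ) +
          ∑ r ∈ Finset.range (M + 1), a r * (i.choose (M + 1 - r) : ℝ) := by
      rw [← Finset.sum_add_distrib]
      refine Finset.sum_congr rfl fun r hr => ?_
      have hr' : r ≤ M := Nat.lt_succ_iff.mp (Finset.mem_range.mp hr)
      rw [Nat.succ_sub hr', Nat.choose_succ_succ]
      push_cast
      ring
    rw [key] at h1
    simp only [Nat.sub_self, Nat.choose_zero_right] at h0 h1
    linarith

/-- Collapse of a double sum restricted to an antidiagonal. -/
lemma sum_sum_ite_eq (A B K : ℕ) (P : ℕ → ℕ → Prop) [∀ r j, Decidable (P r j)]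
    (F : ℕ → ℕ → ℝ) (D : ℝ) (a : ℕ → ℝ) (hP : ∀ r j, r ≤ A → j ≤ B → (P r j ↔ r + j = K))
    (hF : ∀ r j, r ≤ A → j ≤ B → r + j = K → F r j = D * (a r * (B.choose j : ℝ)))
    (ha : ∀ r, A < r → a r = 0) :
    ∑ r ∈ Finset.range (A + 1), ∑ j ∈ Finset.range (B + 1), (if P r j then F r j else 0) =
      D * ∑ r ∈ Finset.range (K + 1), a r * (B.choose (K - r) : ℝ) := by
  have hrow : ∀ r ∈ Finset.range (A + 1),
      ∑ j ∈ Finset.range (B + 1), (if P r j then F r j else 0) =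
        if r ∈ Finset.range (K + 1) then D * (a r * (B.choose (K - r) : ℝ)) else 0 := by
    intro r hr
    have hr' : r ≤ A := Nat.lt_succ_iff.mp (Finset.mem_range.mp hr)
    have hj : ∀ j ∈ Finset.range (B + 1), (if P r j then F r j else 0) =
        if r + j = K then D * (a r * (B.choose j : ℝ)) else 0 := by
      intro j hj
      have hj' : j ≤ B := Nat.lt_succ_iff.mp (Finset.mem_range.mp hj)
      by_cases h : r + j = K
      · rw [if_pos ((hP r j hr' hj').2 h), if_pos h, hF r j hr' hj' h]
      · rw [if_neg (mt (hP r j hr' hj').1 h), if_neg h]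
    rw [Finset.sum_congr rfl hj]
    split_ifs with hK
    · have hK' : r ≤ K := Nat.lt_succ_iff.mp (Finset.mem_range.mp hK)
      rw [Finset.sum_eq_single (K - r)]
      · rw [if_pos (by omega)]
      · intro j _ hne
        rw [if_neg (by omega)]
      · intro hB
        -- Here `K - r > B`, so the binomial coefficient vanishes and the cutoff on `j` is harmless.
        rw [if_pos (by omega), Nat.choose_eq_zero_of_lt (by rw [Finset.mem_range] at hB; omega)]
        simp
    · refine Finset.sum_eq_zero fun j _ => if_neg ?_
      rw [Finset.mem_range] at hK
      omega
  rw [Finset.sum_congr rfl hrow, Finset.mul_sum, Finset.sum_ite_mem]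
  refine Finset.sum_subset Finset.inter_subset_right fun r hrK hr => ?_
  have hrA : A < r := by
    by_contra h
    exact hr (Finset.mem_inter.2 ⟨Finset.mem_range.2 (by omega), hrK⟩)
  rw [ha r hrA, zero_mul, mul_zero]

/-- A matrix element of the amplifier unitary vanishes unless the difference of the photon numbers
is conserved. -/
lemma add_eq_of_ampUnitary_ne_zero {κ : ℝ} {m n : ℕ × ℕ} (h : ampUnitary κ m n ≠ 0) :
    m.2 + n.1 = n.2 + m.1 := by
  by_contra hne
  apply h
  rw [ampUnitary, Matrix.of_apply, Finset.sum_eq_zero, mul_zero, Complex.ofReal_zero]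
  refine fun r hr => Finset.sum_eq_zero fun j hj => if_neg ?_
  simp only [Finset.mem_range] at hr hj
  omega

/-- A matrix element of the attenuator unitary vanishes unless the sum of the photon numbers is
conserved. -/
lemma add_eq_of_attUnitary_ne_zero {κ : ℝ} {m n : ℕ × ℕ} (h : attUnitary κ m n ≠ 0) :
    m.1 + m.2 = n.1 + n.2 := by
  by_contra hne
  apply h
  rw [attUnitary, Matrix.of_apply, Finset.sum_eq_zero, mul_zero, Complex.ofReal_zero]
  refine fun r hr => Finset.sum_eq_zero fun j hj => if_neg ?_
  simp only [Finset.mem_range] at hr hj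
  omega

/-- A matrix element of the phase conjugator unitary vanishes unless the photon numbers satisfy
`m₂ + n₂ = n₁ + m₁`. -/
lemma add_eq_of_conjUnitary_ne_zero {κ : ℝ} {m n : ℕ × ℕ} (h : conjUnitary κ m n ≠ 0) :
    m.2 + n.2 = n.1 + m.1 := by
  by_contra hne
  apply h
  rw [conjUnitary, Matrix.of_apply, Finset.sum_eq_zero, mul_zero, Complex.ofReal_zero]
  refine fun r hr => Finset.sum_eq_zero fun j hj => if_neg ?_
  simp only [Finset.mem_range] at hr hj
  omega

/-- On `r + j = c` the powers are `x ^ (n + c - 2 * r)` and `s ^ (i - c + 2 * r)`. Beyond a factor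
free of `r`, this leaves the weight `(s / x) ^ (2 * r)` and a polynomial of degree `c` in `i`. -/
lemma exists_ampUnitary_ne_zero {κ : ℝ} (hκ : 1 < κ) (n c : ℕ) :
    ∃ i e, c < i ∧ ampUnitary κ (i, e) (c, n) ≠ 0 := by
  have hκ0 : 0 < κ := zero_lt_one.trans hκ
  set x : ℝ := κ⁻¹ with hx
  set s : ℝ := √(1 - x ^ 2) with hs
  have hx0 : 0 < x := inv_pos.2 hκ0
  have hx1 : x < 1 := inv_lt_one_of_one_lt₀ hκ
  have hs0 : 0 < s := Real.sqrt_pos.2 (by nlinarith)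
  obtain ⟨i, hi, hne⟩ := exists_sum_mul_choose_ne_zero
    (fun r => (n.choose r : ℝ) * (-1) ^ r * (s / x) ^ (2 * r)) (by simp) c (c + 1)
  refine ⟨i, n + i - c, hi, ?_⟩
  rw [ampUnitary, Matrix.of_apply, Complex.ofReal_ne_zero]
  refine mul_ne_zero (by positivity) ?_
  rw [sum_sum_ite_eq n i c _ _ (x ^ (n + c) * s ^ (i - c)) _ _ _ _]
  · exact mul_ne_zero (by positivity) hne
  · intro r j hr hj
    simp only
    omega
  · intro r j hr hj h
    have e1 : x ^ (n + c) = x ^ (n + j - r) * x ^ (2 * r) := by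
      rw [← pow_add]; congr 1; omega
    have e2 : s ^ (i + r - j) = s ^ (i - c) * s ^ (2 * r) := by
      rw [← pow_add]; congr 1; omega
    simp only
    rw [← hx, ← hs, e1, e2, div_pow s x]
    field_simp
  · intro r hr
    simp [Nat.choose_eq_zero_of_lt hr]

/-- As for the amplifier, with `c` and `n` exchanged: the polynomial in `i` has degree `n`. -/
lemma exists_conjUnitary_ne_zero {κ : ℝ} (hκ : 0 < κ) (n c : ℕ) :
    ∃ i e, c < i ∧ conjUnitary κ (i, e) (c, n) ≠ 0 := by
  set q : ℝ := √(1 + κ ^ 2) with hq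
  have hq0 : 0 < q := Real.sqrt_pos.2 (by positivity)
  set x : ℝ := q⁻¹ with hx
  set s : ℝ := κ / q with hs
  have hx0 : 0 < x := inv_pos.2 hq0
  have hs0 : 0 < s := div_pos hκ hq0
  -- The bound `c + n + 1` gives both `c < i` and `n ≤ i`, so `i - n` is not truncated.
  obtain ⟨i, hi, hne⟩ := exists_sum_mul_choose_ne_zero
    (fun r => (c.choose r : ℝ) * (-1) ^ r * (s / x) ^ (2 * r)) (by simp) n (c + n + 1)
  refine ⟨i, c + i - n, by omega, ?_⟩
  rw [conjUnitary, Matrix.of_apply, Complex.ofReal_ne_zero]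
  refine mul_ne_zero (by positivity) ?_
  rw [Finset.sum_comm, sum_sum_ite_eq c i n _ _ (x ^ (c + n) * s ^ (i - n)) _ _ _ _]
  · exact mul_ne_zero (by positivity) hne
  · intro r j hr hj
    simp only
    omega
  · intro r j hr hj h
    have e1 : x ^ (c + n) = x ^ (c + j - r) * x ^ (2 * r) := by
      rw [← pow_add]; congr 1; omega
    have e2 : s ^ (i - j + r) = s ^ (i - n) * s ^ (2 * r) := by
      rw [← pow_add]; congr 1; omega
    simp only
    rw [← hq, ← hx, ← hs, e1, e2, div_pow s x]
    field_simp
  · intro r hr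
    simp [Nat.choose_eq_zero_of_lt hr]

/-- The attenuator moves all photons of the environment into the system with non-zero amplitude. -/
lemma attUnitary_add_zero_ne_zero {κ : ℝ} (hκ0 : 0 < κ) (hκ1 : κ < 1) (n c : ℕ) :
    attUnitary κ (c + n, 0) (c, n) ≠ 0 := by
  have hs0 : 0 < √(1 - κ ^ 2) := Real.sqrt_pos.2 (by nlinarith)
  rw [attUnitary, Matrix.of_apply, Complex.ofReal_ne_zero]
  refine mul_ne_zero (by positivity) ?_
  -- An empty output environment forces `r = j = 0`, so no interference occurs.
  rw [Finset.sum_eq_single 0, Finset.sum_eq_single 0]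
  · simp [hκ0.ne', hs0.ne']
  · intro j _ hj
    exact if_neg (by omega)
  · simp
  · intro r _ hr
    exact Finset.sum_eq_zero fun j _ => if_neg (by omega)
  · simp

end PhotonAdded

theorem mainTheorem10 :
    (∀ (κ : ℝ) (n : ℕ), 0 < κ → κ < 1 → 1 ≤ n →
      ¬ ∃ ρ : PhotonAdded.Mode →L[ℂ] PhotonAdded.Mode, PhotonAdded.IsState ρ ∧
        (PhotonAdded.fockSupport ρ).Finite ∧
        PhotonAdded.IsFixedPoint (PhotonAdded.attenuator κ n) ρ) ∧
    (∀ (κ : ℝ) (n : ℕ), 1 < κ →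
      ¬ ∃ ρ : PhotonAdded.Mode →L[ℂ] PhotonAdded.Mode, PhotonAdded.IsState ρ ∧
        (PhotonAdded.fockSupport ρ).Finite ∧
        PhotonAdded.IsFixedPoint (PhotonAdded.amplifier κ n) ρ) ∧
    (∀ (κ : ℝ) (n : ℕ), 0 < κ →
      ¬ ∃ ρ : PhotonAdded.Mode →L[ℂ] PhotonAdded.Mode, PhotonAdded.IsState ρ ∧
        (PhotonAdded.fockSupport ρ).Finite ∧
        PhotonAdded.IsFixedPoint (PhotonAdded.phaseConjugator κ n) ρ) := by
  refine ⟨fun κ n hκ0 hκ1 hn => ?_, fun κ n hκ => ?_, fun κ n hκ => ?_⟩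
  · refine PhotonAdded.not_exists_isFixedPoint (U := PhotonAdded.attUnitary κ) ?_ ?_ fun c =>
      ⟨c + n, 0, by omega, PhotonAdded.attUnitary_add_zero_ne_zero hκ0 hκ1 n c⟩
    all_goals
      intro _ _ _ _ h₁ h₂
      have e₁ := PhotonAdded.add_eq_of_attUnitary_ne_zero h₁
      have e₂ := PhotonAdded.add_eq_of_attUnitary_ne_zero h₂
      simp only at e₁ e₂
      omega
  · refine PhotonAdded.not_exists_isFixedPoint (U := PhotonAdded.ampUnitary κ) ?_ ?_
      (PhotonAdded.exists_ampUnitary_ne_zero hκ n)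
    all_goals
      intro _ _ _ _ h₁ h₂
      have e₁ := PhotonAdded.add_eq_of_ampUnitary_ne_zero h₁
      have e₂ := PhotonAdded.add_eq_of_ampUnitary_ne_zero h₂
      simp only at e₁ e₂
      omega
  · refine PhotonAdded.not_exists_isFixedPoint (U := PhotonAdded.conjUnitary κ) ?_ ?_
      (PhotonAdded.exists_conjUnitary_ne_zero hκ n)
    all_goals
      intro _ _ _ _ h₁ h₂
      have e₁ := PhotonAdded.add_eq_of_conjUnitary_ne_zero h₁
      have e₂ := PhotonAdded.add_eq_of_conjUnitary_ne_zero h₂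
      simp only at e₁ e₂
      omega
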